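/- Let $n>1$ be an integer and let $\mathbb{D}^n=\{z\in\mathbb{C}^n: |z_j|<1,\ j=1,\ldots,n\}$ be the open unit polydisk. Let $K_n^0$ denote the largest number $r\ge 0$ such that, for every holomorphic function $f(z)=\sum_{\alpha\in\mathbb{N}_0^n} c_\alpha z^\alpha$ on $\mathbb{D}^n$ with $f(0)=0$ and $|f(z)|<1$ for all $z\in\mathbb{D}^n$, the inequality $$\sum_{k=1}^{\infty}\ \sum_{|\alpha|=k}|c_\alpha z^\alpha|\le 1$$ holds for all $z\in r\cdot\mathbb{D}^n$. This largest number exists, and $$K_n^0\ge\frac{1}{\sqrt{2n}},\qquad K_n^0\le\begin{cases}\dfrac{1}{\sqrt2}, & n=2,\\[2mm] \dfrac{2\sqrt{\log n}}{\sqrt n}, & n>2.\end{cases}$$ -/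

import Mathlib

open scoped Pointwise

/-- The open unit polydisk `𝔻ⁿ` in `ℂⁿ`. -/
def unitPolydisk (n : ℕ) : Set (Fin n → ℂ) :=
  {z | ∀ j, ‖z j‖ < 1}

/-- The monomial `z^α = z₁^α₁ ⋯ zₙ^αₙ`. -/
def monom {n : ℕ} (α : Fin n → ℕ) (z : Fin n → ℂ) : ℂ :=
  ∏ j, z j ^ α j

/-- `f` is holomorphic in the unit polydisk with power series expansion `f(z) = ∑_α c_α z^α` there.
The family `c` exists and is unique for every holomorphic `f`, and convergence of a
multiple power series is understood, as usual, as unconditional (absolute) convergence. -/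
structure IsHolomorphicWithExpansion {n : ℕ} (f : (Fin n → ℂ) → ℂ) (c : (Fin n → ℕ) → ℂ) :
    Prop where
  holomorphic : DifferentiableOn ℂ f (unitPolydisk n)
  expansion : ∀ z ∈ unitPolydisk n, HasSum (fun α => c α * monom α z) (f z)

/-- The full monomial sum `∑_{k ≥ 1} ∑_{|α| = k} |c_α z^α|`, with value `∞` if it diverges. -/
noncomputable def monomialSum {n : ℕ} (c : (Fin n → ℕ) → ℂ) (z : Fin n → ℂ) : ENNReal :=
  ∑' k : ℕ, ∑ α ∈ Finset.piAntidiag (Finset.univ : Finset (Fin n)) (k + 1), ‖c α * monom α z‖ₑ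

/-- The radii `r ≥ 0` such that, for every holomorphic `f(z) = ∑_α c_α z^α` in `𝔻ⁿ` with
`f(0) = 0` and `|f| < 1`, the full monomial sum is at most `1` in `r · 𝔻ⁿ`. -/
def bohrRadiiZero (n : ℕ) : Set ℝ :=
  {r | 0 ≤ r ∧ ∀ (f : (Fin n → ℂ) → ℂ) (c : (Fin n → ℕ) → ℂ),
    IsHolomorphicWithExpansion f c → f 0 = 0 → (∀ z ∈ unitPolydisk n, ‖f z‖ < 1) →
      ∀ z ∈ r • unitPolydisk n, monomialSum c z ≤ 1}

/-- The Bohr radius `Kₙ⁰`. -/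
noncomputable def bohrRadiusZero (n : ℕ) : ℝ :=
  sSup (bohrRadiiZero n)

/-! Lower bound: Bessel's inequality on the torus gives `∑ |c_α|² ≤ 1`. By Cauchy–Schwarz the sum
over `α ≠ 0` is at most `1` once `∑_{α ≠ 0} |z^α|² = ∏ (1 - |z_j|²)⁻¹ - 1 ≤ 1`. Bernoulli's
inequality gives this for `|z_j|² ≤ 1/(2n)` (`one_div_sqrt_mem_bohrRadiiZero`). The supremum is
attained because `r · 𝔻ⁿ` is open: each of its points already lies in a smaller admissible polydisk.

The upper bound `1/√2` comes from the one-variable function `w (a - w)/(1 - a w)` with `a = 1/√2`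
(`le_one_div_sqrt_two_of_mem`).

For the logarithmic bound, split `(k + 1) m ≤ n` variables into `k + 1` blocks of size `m`, and give
the multilinear form in them the unimodular coefficients `∏ χ(i_l i_{l+1})`. Summing out one block
at a time by Parseval bounds it on the polydisk by `m^((k+2)/2)` (`norm_sq_chain_le`), while it has
`m^(k+1)` coefficients. Hence `r^(2(k+1)) m^k ≤ 1` (`sq_pow_mul_pow_le_one`). With `k` the integer
part of `log n`, `m^(1/(k+1)) ≤ e` and `m ≈ n/(k+1)`, so `r²` is at most about `e (k+1)/n`, below `4
log n / n` for `n ≥ 55`. Smaller `n` use `1/√2` or the bilinear case `k = 1`. -/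

/-! ### Monomial sums through finite sums -/

open Finset in
/-- The full monomial sum is at most `1` if and only if all finite sums over nonzero exponents
are. -/
theorem monomialSum_le_one_iff {n : ℕ} {c : (Fin n → ℕ) → ℂ} {z : Fin n → ℂ} :
    monomialSum c z ≤ 1 ↔
      ∀ S : Finset (Fin n → ℕ), 0 ∉ S → ∑ α ∈ S, ‖c α * monom α z‖ ≤ 1 := by
  classical
  have hdisj : ∀ K : ℕ, ((range K : Finset ℕ) : Set ℕ).PairwiseDisjoint
      (fun k => piAntidiag (univ : Finset (Fin n)) (k + 1)) := by
    intro K k _ l _ hkl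
    refine Finset.disjoint_left.2 fun α h1 h2 => hkl ?_
    rw [mem_piAntidiag] at h1 h2
    have := h1.1.symm.trans h2.1
    omega
  have hcast : ∀ T : Finset (Fin n → ℕ),
      ∑ α ∈ T, ‖c α * monom α z‖ₑ = ENNReal.ofReal (∑ α ∈ T, ‖c α * monom α z‖) := by
    intro T
    rw [ENNReal.ofReal_sum_of_nonneg fun _ _ => norm_nonneg _]
    simp only [ofReal_norm]
  constructor
  · intro h S hS
    set K := S.sup fun α => ∑ j, α j
    have hsub : S ⊆ (range K).biUnion fun k => piAntidiag (univ : Finset (Fin n)) (k + 1) := by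
      intro α hα
      have h1 : ∑ j, α j ≤ K := Finset.le_sup (f := fun α : Fin n → ℕ => ∑ j, α j) hα
      have h2 : ∑ j, α j ≠ 0 := by
        intro h0
        apply hS
        have : α = 0 := by
          funext j
          exact (Finset.sum_eq_zero_iff.1 h0) j (mem_univ j)
        exact this ▸ hα
      rw [mem_biUnion]
      refine ⟨∑ j, α j - 1, by rw [mem_range]; omega, ?_⟩
      rw [mem_piAntidiag]
      exact ⟨by show ∑ j, α j = _; omega, fun i _ => mem_univ i⟩
    have h3 : ∑ α ∈ S, ‖c α * monom α z‖ₑ ≤ 1 :=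
      calc ∑ α ∈ S, ‖c α * monom α z‖ₑ
          ≤ ∑ α ∈ (range K).biUnion fun k => piAntidiag (univ : Finset (Fin n)) (k + 1),
              ‖c α * monom α z‖ₑ := Finset.sum_le_sum_of_subset hsub
        _ = ∑ k ∈ range K, ∑ α ∈ piAntidiag (univ : Finset (Fin n)) (k + 1),
              ‖c α * monom α z‖ₑ := Finset.sum_biUnion (hdisj K)
        _ ≤ monomialSum c z := ENNReal.sum_le_tsum _
        _ ≤ 1 := h
    rw [hcast, ← ENNReal.ofReal_one] at h3
    exact (ENNReal.ofReal_le_ofReal_iff zero_le_one).1 h3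
  · intro h
    refine ENNReal.tsum_le_of_sum_range_le fun K => ?_
    rw [← Finset.sum_biUnion (hdisj K), hcast, ← ENNReal.ofReal_one]
    refine ENNReal.ofReal_le_ofReal (h _ ?_)
    intro h0
    obtain ⟨k, -, hk⟩ := mem_biUnion.1 h0
    have := (mem_piAntidiag.1 hk).1
    simp at this

theorem norm_monom {n : ℕ} (α : Fin n → ℕ) (z : Fin n → ℂ) :
    ‖monom α z‖ = ∏ j, ‖z j‖ ^ α j := by
  simp [monom, norm_prod, norm_pow]

theorem monom_const {n : ℕ} (α : Fin n → ℕ) (w : ℂ) :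
    monom α (fun _ => w) = w ^ ∑ j, α j := by
  simp [monom, Finset.prod_pow_eq_pow_sum]

/-! ### Bessel's inequality for the coefficients -/

section Torus

open MeasureTheory UnitAddTorus

attribute [local instance] instMeasureSpaceUnitAddCircle
attribute [local instance] instIsProbabilityMeasureUnitAddCircleVolume

/-- Bessel's inequality for an absolutely convergent power series on the unit torus. -/
theorem sum_norm_sq_le_of_hasSum_mFourier {n : ℕ} {a : (Fin n → ℕ) → ℂ}
    {G : C(UnitAddTorus (Fin n), ℂ)}
    (hG : HasSum (fun α => a α • mFourier fun j => (α j : ℤ)) G) (hb : ∀ θ, ‖G θ‖ ≤ 1)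
    (S : Finset (Fin n → ℕ)) : ∑ α ∈ S, ‖a α‖ ^ 2 ≤ 1 := by
  classical
  set T := ContinuousMap.toLp (E := ℂ) 2 (volume : Measure (UnitAddTorus (Fin n))) ℂ with hT
  have hTG : ‖T G‖ ≤ 1 := by
    have := Lp.norm_le_of_ae_bound (f := T G) (C := 1) zero_le_one (by
      filter_upwards [ContinuousMap.coeFn_toLp (p := 2) (𝕜 := ℂ) volume G] with θ hθ
      rw [hT, hθ]
      exact hb θ)
    simpa [measureUnivNNReal] using this
  have hinj : Function.Injective fun (α : Fin n → ℕ) (j : Fin n) => (α j : ℤ) := by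
    intro α β h
    funext j
    simpa using congrFun h j
  have horth : Orthonormal ℂ
      fun α : Fin n → ℕ => mFourierLp (d := Fin n) 2 fun j => (α j : ℤ) :=
    (orthonormal_mFourier (d := Fin n)).comp _ hinj
  have hTsum : HasSum (fun α => a α • mFourierLp (d := Fin n) 2 fun j => (α j : ℤ)) (T G) := by
    have := T.hasSum hG
    simpa only [map_smul] using this
  have hcoef : ∀ β : Fin n → ℕ,
      inner ℂ (mFourierLp (d := Fin n) 2 fun j => (β j : ℤ)) (T G) = a β := by
    intro β
    have e1 := (innerSL ℂ (mFourierLp (d := Fin n) 2 fun j => (β j : ℤ))).hasSum hTsum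
    have e2 : HasSum (fun α => if α = β then a β else 0) (a β) := hasSum_ite_eq β (a β)
    refine HasSum.unique e1 ?_
    convert! e2 using 2 with α
    have := (orthonormal_iff_ite.1 horth) β α
    rw [map_smul, innerSL_apply_apply, this]
    by_cases h : α = β
    · subst h; simp
    · simp [h, Ne.symm h]
  have := horth.sum_inner_products_le (x := T G) (s := S)
  simp only [hcoef] at this
  exact this.trans (by nlinarith [norm_nonneg (T G)])

/-- Bessel's inequality on the torus of radius `ρ < 1` for a bounded holomorphic function. -/
theorem sum_sq_coeff_mul_pow_le_one {n : ℕ} {f : (Fin n → ℂ) → ℂ} {c : (Fin n → ℕ) → ℂ}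
    (hf : IsHolomorphicWithExpansion f c) (hb : ∀ z ∈ unitPolydisk n, ‖f z‖ < 1)
    {ρ : ℝ} (h0 : 0 ≤ ρ) (h1 : ρ < 1) (S : Finset (Fin n → ℕ)) :
    ∑ α ∈ S, (‖c α‖ * ρ ^ ∑ j, α j) ^ 2 ≤ 1 := by
  set a : (Fin n → ℕ) → ℂ := fun α => c α * (ρ : ℂ) ^ ∑ j, α j with ha
  have hρ : ‖(ρ : ℂ)‖ < 1 := by simpa [abs_of_nonneg h0] using h1
  have hsum : Summable fun α => ‖a α‖ := by
    have := (hf.expansion (fun _ => (ρ : ℂ)) fun _ => hρ).summable.norm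
    simpa [ha, monom_const] using this
  -- Characters have sup norm `1`, so the series converges uniformly on the torus; this is why `ρ <
  -- 1` is needed.
  have hsm : Summable fun α : Fin n → ℕ => a α • mFourier fun j => (α j : ℤ) := by
    refine Summable.of_norm ?_
    simpa [norm_smul, mFourier_norm] using hsum
  obtain ⟨G, hG⟩ := hsm
  have hGval : ∀ θ, ‖G θ‖ ≤ 1 := by
    intro θ
    have e1 := (ContinuousMap.evalCLM ℂ θ).hasSum hG
    have hz : (fun j => (ρ : ℂ) * fourier 1 (θ j)) ∈ unitPolydisk n := by
      intro j
      rw [norm_mul, fourier_apply, Circle.norm_coe, mul_one]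
      exact hρ
    have e2 := hf.expansion _ hz
    have e3 : G θ = f fun j => (ρ : ℂ) * fourier 1 (θ j) := by
      refine HasSum.unique e1 ?_
      convert! e2 using 2 with α
      have e4 : mFourier (fun j => (α j : ℤ)) θ = ∏ j, (fourier 1 (θ j)) ^ α j := by
        simp only [mFourier, ContinuousMap.coe_mk]
        refine Finset.prod_congr rfl fun j _ => ?_
        simp [fourier_apply, AddCircle.toCircle_nsmul]
      simp only [map_smul, ContinuousMap.evalCLM_apply, e4, ha, monom, mul_pow,
        Finset.prod_mul_distrib, Finset.prod_pow_eq_pow_sum, smul_eq_mul, mul_assoc]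
    rw [e3]
    exact (hb _ hz).le
  have := sum_norm_sq_le_of_hasSum_mFourier hG hGval S
  simpa [ha, norm_mul, norm_pow, abs_of_nonneg h0] using this

end Torus

-- A finite sum is continuous in the radius, so `ρ → 1` is harmless.
open Filter Topology in
theorem sum_sq_coeff_le_one {n : ℕ} {f : (Fin n → ℂ) → ℂ} {c : (Fin n → ℕ) → ℂ}
    (hf : IsHolomorphicWithExpansion f c) (hb : ∀ z ∈ unitPolydisk n, ‖f z‖ < 1)
    (S : Finset (Fin n → ℕ)) : ∑ α ∈ S, ‖c α‖ ^ 2 ≤ 1 := by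
  have hcont : Continuous fun ρ : ℝ => ∑ α ∈ S, (‖c α‖ * ρ ^ ∑ j, α j) ^ 2 := by fun_prop
  have hlim := (hcont.tendsto 1).mono_left (nhdsWithin_le_nhds (s := Set.Iio 1))
  simp only [one_pow, mul_one] at hlim
  refine le_of_tendsto hlim ?_
  filter_upwards [Ioo_mem_nhdsLT (zero_lt_one (α := ℝ))] with ρ hρ
  exact sum_sq_coeff_mul_pow_le_one hf hb hρ.1.le hρ.2 S

/-! ### The lower bound and attainment of the supremum -/

/-- Multiply out a product of geometric series over a box of exponents containing `S`; the `1` is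
the term `α = 0`. -/
theorem sum_monom_sq_add_one_le {n : ℕ} {x : Fin n → ℝ} (h0 : ∀ j, 0 ≤ x j) (h1 : ∀ j, x j < 1)
    (S : Finset (Fin n → ℕ)) (hS : 0 ∉ S) :
    ∑ α ∈ S, ∏ j, x j ^ α j + 1 ≤ ∏ j, (1 - x j)⁻¹ := by
  classical
  set K := S.sup (fun α => ∑ j, α j) + 1 with hK
  have hsub : insert 0 S ⊆ Fintype.piFinset fun _ : Fin n => Finset.range K := by
    intro α hα
    rw [Fintype.mem_piFinset]
    intro j
    rcases Finset.mem_insert.1 hα with rfl | hα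
    · simp [hK]
    · have h2 : ∑ j, α j ≤ S.sup (fun α => ∑ j, α j) :=
        Finset.le_sup (f := fun α : Fin n → ℕ => ∑ j, α j) hα
      have h3 : α j ≤ ∑ j, α j := Finset.single_le_sum (fun _ _ => Nat.zero_le _) (Finset.mem_univ j)
      rw [Finset.mem_range]
      omega
  have hnn : ∀ α : Fin n → ℕ, 0 ≤ ∏ j, x j ^ α j :=
    fun α => Finset.prod_nonneg fun j _ => pow_nonneg (h0 j) _
  calc ∑ α ∈ S, ∏ j, x j ^ α j + 1 = ∑ α ∈ insert 0 S, ∏ j, x j ^ α j := by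
        rw [Finset.sum_insert hS]; simp [add_comm]
    _ ≤ ∑ α ∈ Fintype.piFinset fun _ : Fin n => Finset.range K, ∏ j, x j ^ α j :=
        Finset.sum_le_sum_of_subset_of_nonneg hsub fun α _ _ => hnn α
    _ = ∏ j, ∑ k ∈ Finset.range K, x j ^ k := (Finset.prod_univ_sum _ _).symm
    _ ≤ ∏ j, (1 - x j)⁻¹ := by
        refine Finset.prod_le_prod (fun j _ => Finset.sum_nonneg fun k _ => pow_nonneg (h0 j) _)
          fun j _ => ?_
        have := hasSum_geometric_of_lt_one (h0 j) (h1 j)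
        exact sum_le_hasSum _ (fun k _ => pow_nonneg (h0 j) _) this

/-- If `∏ (1 - |z_j|²) ≥ 1/2`, the full monomial sum of a function bounded by one is at most one. -/
theorem monomialSum_le_one_of_half_le_prod {n : ℕ} {f : (Fin n → ℂ) → ℂ} {c : (Fin n → ℕ) → ℂ}
    (hf : IsHolomorphicWithExpansion f c) (hb : ∀ z ∈ unitPolydisk n, ‖f z‖ < 1)
    {z : Fin n → ℂ} (hz : z ∈ unitPolydisk n) (hp : 1 / 2 ≤ ∏ j, (1 - ‖z j‖ ^ 2)) :
    monomialSum c z ≤ 1 := by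
  rw [monomialSum_le_one_iff]
  intro S hS
  have h1 := sum_sq_coeff_le_one hf hb S
  have h2 := sum_monom_sq_add_one_le (x := fun j => ‖z j‖ ^ 2) (fun j => by positivity)
    (fun j => by nlinarith [hz j, norm_nonneg (z j)]) S hS
  have h3 : ∏ j, (1 - ‖z j‖ ^ 2)⁻¹ ≤ 2 := by
    rw [Finset.prod_inv_distrib]
    calc _ ≤ (1 / 2 : ℝ)⁻¹ := inv_anti₀ (by norm_num) hp
      _ = 2 := by norm_num
  have h4 : ∑ α ∈ S, ‖monom α z‖ ^ 2 ≤ 1 := by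
    have : ∀ α : Fin n → ℕ, ‖monom α z‖ ^ 2 = ∏ j, (‖z j‖ ^ 2) ^ α j := by
      intro α
      rw [norm_monom, ← Finset.prod_pow]
      exact Finset.prod_congr rfl fun j _ => pow_right_comm _ _ _
    simp only [this]
    linarith
  have h5 := Finset.sum_mul_sq_le_sq_mul_sq S (fun α => ‖c α‖) (fun α => ‖monom α z‖)
  have h6 : (∑ α ∈ S, ‖c α‖ * ‖monom α z‖) ^ 2 ≤ 1 :=
    h5.trans (mul_le_one₀ h1 (Finset.sum_nonneg fun _ _ => by positivity) h4)
  simp only [norm_mul]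
  exact (abs_le_one_iff_mul_self_le_one.2 (by rwa [← sq])) |> (le_abs_self _).trans

theorem mem_smul_unitPolydisk_iff {n : ℕ} {r : ℝ} (hr : 0 < r) {z : Fin n → ℂ} :
    z ∈ r • unitPolydisk n ↔ ∀ j, ‖z j‖ < r := by
  rw [Set.mem_smul_set_iff_inv_smul_mem₀ hr.ne']
  refine forall_congr' fun j => ?_
  rw [Pi.smul_apply, norm_smul, norm_inv, Real.norm_of_nonneg hr.le, inv_mul_lt_iff₀ hr, mul_one]

theorem one_div_sqrt_mem_bohrRadiiZero {n : ℕ} (hn : 1 ≤ n) :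
    1 / √(2 * (n : ℝ)) ∈ bohrRadiiZero n := by
  have hn' : (1 : ℝ) ≤ n := by exact_mod_cast hn
  have hpos : 0 < 1 / √(2 * (n : ℝ)) := by positivity
  refine ⟨hpos.le, fun f c hf _ hb z hz => ?_⟩
  rw [mem_smul_unitPolydisk_iff hpos] at hz
  have hsq : ∀ j, ‖z j‖ ^ 2 ≤ 1 / (2 * n) := by
    intro j
    calc ‖z j‖ ^ 2 ≤ (1 / √(2 * (n : ℝ))) ^ 2 := by gcongr; exact (hz j).le
      _ = 1 / (2 * (n : ℝ)) := by rw [div_pow, Real.sq_sqrt (by positivity), one_pow]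
  have hle : 1 / (2 * (n : ℝ)) ≤ 1 / 2 := by
    gcongr
    linarith
  refine monomialSum_le_one_of_half_le_prod hf hb (fun j => ?_) ?_
  · nlinarith [hsq j, norm_nonneg (z j)]
  · calc (1 / 2 : ℝ) = 1 + n * -(1 / (2 * n)) := by field_simp; ring
      _ ≤ (1 + -(1 / (2 * (n : ℝ)))) ^ n := one_add_mul_le_pow (by linarith) n
      _ = ∏ _j : Fin n, (1 - 1 / (2 * (n : ℝ))) := by simp [sub_eq_add_neg]
      _ ≤ ∏ j, (1 - ‖z j‖ ^ 2) :=
        Finset.prod_le_prod (fun _ _ => by linarith) fun j _ => by linarith [hsq j]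

/-- If the radii are bounded above, the largest one exists. -/
theorem isGreatest_bohrRadiusZero {n : ℕ} (hn : 1 ≤ n) (hbdd : BddAbove (bohrRadiiZero n)) :
    IsGreatest (bohrRadiiZero n) (bohrRadiusZero n) := by
  have hmem := one_div_sqrt_mem_bohrRadiiZero hn
  have hn' : (1 : ℝ) ≤ n := by exact_mod_cast hn
  have hpos : 0 < bohrRadiusZero n := lt_of_lt_of_le (by positivity) (le_csSup hbdd hmem)
  refine ⟨⟨hpos.le, fun f c hf h0 hb z hz => ?_⟩, fun r hr => le_csSup hbdd hr⟩
  rw [mem_smul_unitPolydisk_iff hpos] at hz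
  have hz' : ‖z‖ < bohrRadiusZero n := (pi_norm_lt_iff hpos).2 hz
  obtain ⟨r, hr, hzr⟩ := exists_lt_of_lt_csSup ⟨_, hmem⟩ hz'
  refine hr.2 f c hf h0 hb z ?_
  have hr0 : 0 < r := (norm_nonneg z).trans_lt hzr
  rw [mem_smul_unitPolydisk_iff hr0]
  exact (pi_norm_lt_iff hr0).1 hzr

/-! ### Chain forms built from additive characters -/

/-- The discrete Fourier transform scales the `ℓ²` norm by `√m`. -/
theorem sum_norm_sq_stdAddChar {m : ℕ} [NeZero m] (g : ZMod m → ℂ) :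
    ∑ y, ‖∑ x, g x * ZMod.stdAddChar (x * y)‖ ^ 2 = m * ∑ x, ‖g x‖ ^ 2 := by
  have key : ∑ y, (∑ x, g x * ZMod.stdAddChar (x * y)) *
      (starRingEnd ℂ) (∑ x, g x * ZMod.stdAddChar (x * y)) =
      m * ∑ x, g x * (starRingEnd ℂ) (g x) := by
    simp only [map_sum, map_mul, Finset.sum_mul_sum]
    rw [Finset.sum_comm]
    rw [Finset.mul_sum]
    refine Finset.sum_congr rfl fun x _ => ?_
    rw [Finset.sum_comm]
    have hinner : ∀ x', ∑ y, g x * ZMod.stdAddChar (x * y) *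
        ((starRingEnd ℂ) (g x') * (starRingEnd ℂ) (ZMod.stdAddChar (x' * y))) =
        g x * (starRingEnd ℂ) (g x') * if x - x' = 0 then (m : ℂ) else 0 := by
      intro x'
      have h := AddChar.sum_mulShift (x - x') (ZMod.isPrimitive_stdAddChar m)
      rw [ZMod.card] at h
      push_cast at h
      rw [← h, Finset.mul_sum]
      refine Finset.sum_congr rfl fun y _ => ?_
      rw [← AddChar.map_neg_eq_conj]
      rw [show y * (x - x') = x * y + -(x' * y) by ring, AddChar.map_add_eq_mul]
      ring
    simp only [hinner, sub_eq_zero]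
    simp
    ring
  have h2 : ∀ w : ℂ, ((‖w‖ ^ 2 : ℝ) : ℂ) = w * (starRingEnd ℂ) w := by
    intro w
    rw [Complex.mul_conj, Complex.normSq_eq_norm_sq]
  apply Complex.ofReal_injective
  rw [Complex.ofReal_mul, Complex.ofReal_sum, Complex.ofReal_sum]
  simp only [h2, Complex.ofReal_natCast]
  exact key

/-- The multilinear form with coefficients `∏ χ(i_k i_{k+1})`, with weight `g` on the first block,
satisfies an `ℓ²` bound. -/
theorem norm_sq_chain_le {m : ℕ} [NeZero m] (k : ℕ) :
    ∀ (g : ZMod m → ℂ) (u : Fin k → ZMod m → ℂ), (∀ j x, ‖u j x‖ ≤ 1) →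
      ‖∑ i : Fin (k + 1) → ZMod m, g (i 0) *
        ∏ j : Fin k, ((ZMod.stdAddChar (i j.castSucc * i j.succ) : ℂ) * u j (i j.succ))‖ ^ 2
      ≤ (m : ℝ) ^ (k + 1) * ∑ x, ‖g x‖ ^ 2 := by
  induction k with
  | zero =>
    intro g u _
    have e : ∑ i : Fin (0 + 1) → ZMod m, g (i 0) = ∑ x, g x :=
      Fintype.sum_equiv (Equiv.funUnique (Fin 1) (ZMod m)) _ _ fun i => rfl
    simp only [Finset.univ_eq_empty, Finset.prod_empty, mul_one, e]
    have h1 : ‖∑ x, g x‖ ≤ ∑ x, ‖g x‖ := norm_sum_le _ _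
    have h2 := sq_sum_le_card_mul_sum_sq (s := (Finset.univ : Finset (ZMod m)))
      (f := fun x => ‖g x‖)
    rw [Finset.card_univ, ZMod.card] at h2
    calc _ ≤ (∑ x, ‖g x‖) ^ 2 := by gcongr
      _ ≤ _ := by simpa using h2
  | succ k ih =>
    intro g u hu
    -- Summing out `i 0` leaves a shorter chain with weight `g'`; Parseval and `‖u 0 y‖ ≤ 1` cost
    -- only one factor `m`.
    set g' : ZMod m → ℂ := fun y => (∑ x, g x * ZMod.stdAddChar (x * y)) * u 0 y with hg'
    have hsq : ∑ y, ‖g' y‖ ^ 2 ≤ m * ∑ x, ‖g x‖ ^ 2 := by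
      rw [← sum_norm_sq_stdAddChar]
      refine Finset.sum_le_sum fun y _ => ?_
      rw [hg', norm_mul]
      gcongr
      exact mul_le_of_le_one_right (norm_nonneg _) (hu 0 y)
    have e : ∑ i : Fin (k + 1 + 1) → ZMod m, g (i 0) *
        ∏ j : Fin (k + 1), ((ZMod.stdAddChar (i j.castSucc * i j.succ) : ℂ) * u j (i j.succ)) =
        ∑ i : Fin (k + 1) → ZMod m, g' (i 0) *
        ∏ j : Fin k, ((ZMod.stdAddChar (i j.castSucc * i j.succ) : ℂ) *
          u j.succ (i j.succ)) := by
      rw [← (Fin.consEquiv fun _ : Fin (k + 1 + 1) => ZMod m).sum_comp, Fintype.sum_prod_type,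
        Finset.sum_comm]
      refine Finset.sum_congr rfl fun i _ => ?_
      simp only [hg', Fin.consEquiv_apply, Finset.sum_mul]
      refine Finset.sum_congr rfl fun x _ => ?_
      rw [Fin.prod_univ_succ]
      simp only [Fin.castSucc_zero, Fin.cons_zero, Fin.cons_succ, Fin.castSucc_succ]
      ring
    rw [e]
    calc _ ≤ (m : ℝ) ^ (k + 1) * ∑ y, ‖g' y‖ ^ 2 := ih g' _ fun j x => hu j.succ x
      _ ≤ (m : ℝ) ^ (k + 1) * (m * ∑ x, ‖g x‖ ^ 2) := by gcongr
      _ = _ := by ring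

/-! ### The one-variable extremal function -/

/-- The Taylor coefficients of `w ↦ w (a - w) / (1 - a w)`. -/
def blaschkeCoeff (a : ℝ) : ℕ → ℂ
  | 0 => 0
  | 1 => a
  | k + 2 => -(1 - (a : ℂ) ^ 2) * (a : ℂ) ^ k

theorem one_sub_mul_ne_zero {a : ℝ} (h0 : 0 ≤ a) (h1 : a < 1) {w : ℂ} (hw : ‖w‖ < 1) :
    1 - (a : ℂ) * w ≠ 0 := by
  intro h
  have : ‖(a : ℂ) * w‖ = 1 := by rw [← sub_eq_zero.1 h, norm_one]
  rw [norm_mul, Complex.norm_real, Real.norm_of_nonneg h0] at this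
  nlinarith [norm_nonneg w]

theorem hasSum_blaschkeCoeff {a : ℝ} (h0 : 0 ≤ a) (h1 : a < 1) {w : ℂ} (hw : ‖w‖ < 1) :
    HasSum (fun k => blaschkeCoeff a k * w ^ k) (w * ((a - w) / (1 - a * w))) := by
  have hne := one_sub_mul_ne_zero h0 h1 hw
  have hlt : ‖(a : ℂ) * w‖ < 1 := by
    rw [norm_mul, Complex.norm_real, Real.norm_of_nonneg h0]
    nlinarith [norm_nonneg w]
  have h := (hasSum_geometric_of_norm_lt_one hlt).mul_left (-(1 - (a : ℂ) ^ 2) * w ^ 2)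
  have h2 : HasSum (fun k => blaschkeCoeff a (k + 2) * w ^ (k + 2))
      (-(1 - (a : ℂ) ^ 2) * w ^ 2 * (1 - a * w)⁻¹) := by
    convert! h using 2 with k
    simp only [blaschkeCoeff]
    ring
  have h3 := (hasSum_nat_add_iff (f := fun k => blaschkeCoeff a k * w ^ k) 2).1 h2
  convert! h3 using 1
  simp only [Finset.sum_range_succ, Finset.sum_range_zero, blaschkeCoeff, div_eq_mul_inv]
  linear_combination ((a : ℂ) * w) * mul_inv_cancel₀ hne

/-- Rests on `|1 - a w|² - |a - w|² = (1 - a²)(1 - |w|²)`. -/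
theorem norm_blaschke_lt_one {a : ℝ} (h0 : 0 ≤ a) (h1 : a < 1) {w : ℂ} (hw : ‖w‖ < 1) :
    ‖w * ((a - w) / (1 - a * w))‖ < 1 := by
  have hne := one_sub_mul_ne_zero h0 h1 hw
  have hsq : ‖(a : ℂ) - w‖ ^ 2 ≤ ‖1 - (a : ℂ) * w‖ ^ 2 := by
    have hw2 : Complex.normSq w < 1 := by
      rw [Complex.normSq_eq_norm_sq]; nlinarith [norm_nonneg w]
    rw [← Complex.normSq_eq_norm_sq, ← Complex.normSq_eq_norm_sq]
    rw [Complex.normSq_apply] at hw2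
    simp only [Complex.normSq_apply, Complex.sub_re, Complex.sub_im, Complex.mul_re,
      Complex.mul_im, Complex.ofReal_re, Complex.ofReal_im, Complex.one_re, Complex.one_im]
    have : 0 ≤ (1 - a ^ 2) * (1 - (w.re * w.re + w.im * w.im)) :=
      mul_nonneg (by nlinarith) (by linarith)
    nlinarith
  have hle : ‖(a - w) / (1 - a * w)‖ ≤ 1 := by
    rw [norm_div]
    exact div_le_one_of_le₀ (le_of_sq_le_sq hsq (norm_nonneg _)) (norm_nonneg _)
  rw [norm_mul]
  calc ‖w‖ * _ ≤ ‖w‖ * 1 := by gcongr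
    _ < 1 := by simpa using hw

theorem hasSum_norm_blaschkeCoeff {a : ℝ} (h0 : 0 ≤ a) (h1 : a < 1) {t : ℝ} (ht0 : 0 ≤ t)
    (ht : t < 1) :
    HasSum (fun k => ‖blaschkeCoeff a k‖ * t ^ k)
      (a * t + (1 - a ^ 2) * t ^ 2 / (1 - a * t)) := by
  have h := (hasSum_geometric_of_lt_one (mul_nonneg h0 ht0) (by nlinarith : a * t < 1)).mul_left
    ((1 - a ^ 2) * t ^ 2)
  have hn : ‖1 - (a : ℂ) ^ 2‖ = 1 - a ^ 2 := by
    rw [← Complex.ofReal_pow, ← Complex.ofReal_one, ← Complex.ofReal_sub, Complex.norm_real,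
      Real.norm_of_nonneg (by nlinarith)]
  have h2 : HasSum (fun k => ‖blaschkeCoeff a (k + 2)‖ * t ^ (k + 2))
      ((1 - a ^ 2) * t ^ 2 * (1 - a * t)⁻¹) := by
    convert! h using 2 with k
    simp only [blaschkeCoeff, norm_mul, norm_neg, hn, norm_pow, Complex.norm_real,
      Real.norm_of_nonneg h0]
    ring
  have h3 := (hasSum_nat_add_iff (f := fun k => ‖blaschkeCoeff a k‖ * t ^ k) 2).1 h2
  convert! h3 using 1
  simp only [Finset.sum_range_succ, Finset.sum_range_zero, blaschkeCoeff]
  simp [abs_of_nonneg h0]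
  ring

/-- Extending a one-variable power series to the polydisk through the first coordinate. -/
theorem isHolomorphicWithExpansion_blaschke {n : ℕ} (j₀ : Fin n) {a : ℝ} (h0 : 0 ≤ a) (h1 : a < 1) :
    IsHolomorphicWithExpansion
      (fun z : Fin n → ℂ => z j₀ * ((a - z j₀) / (1 - a * z j₀)))
      (Function.extend (fun k : ℕ => (Pi.single j₀ k : Fin n → ℕ)) (blaschkeCoeff a) 0) := by
  have hinj : Function.Injective fun k : ℕ => (Pi.single j₀ k : Fin n → ℕ) :=
    fun k l h => by simpa using congrFun h j₀
  refine ⟨?_, fun z hz => ?_⟩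
  · intro z hz
    have := one_sub_mul_ne_zero h0 h1 (hz j₀)
    apply DifferentiableAt.differentiableWithinAt
    fun_prop (disch := exact this)
  · rw [← hinj.hasSum_iff]
    · convert! hasSum_blaschkeCoeff h0 h1 (hz j₀) using 2 with k
      simp only [Function.comp, hinj.extend_apply, monom]
      congr 1
      rw [Finset.prod_eq_single j₀] <;> simp +contextual
    · intro α hα
      rw [Function.extend_apply' _ _ _ (by simpa using hα)]
      simp

theorem le_one_div_sqrt_two_of_mem {n : ℕ} (hn : 0 < n) {r : ℝ} (hr : r ∈ bohrRadiiZero n) :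
    r ≤ 1 / √2 := by
  set a : ℝ := 1 / √2 with ha
  have ha2 : a ^ 2 = 1 / 2 := by rw [ha, div_pow, Real.sq_sqrt (by norm_num)]; norm_num
  have h0 : 0 < a := by positivity
  have h1 : a < 1 := by nlinarith
  by_contra! hlt
  -- The majorant equals `1` exactly at `t = a`, so any `t > a` gives a contradiction; `t < 1` keeps
  -- the series convergent.
  obtain ⟨t, ht1, ht2⟩ := exists_between (lt_min hlt h1)
  have htr := ht2.trans_le (min_le_left _ _)
  have ht := ht2.trans_le (min_le_right _ _)
  have ht0 : 0 < t := h0.trans ht1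
  set j₀ : Fin n := ⟨0, hn⟩
  have hinj : Function.Injective fun k : ℕ => (Pi.single j₀ k : Fin n → ℕ) :=
    fun k l h => by simpa using congrFun h j₀
  have hz : (Pi.single j₀ (t : ℂ) : Fin n → ℂ) ∈ r • unitPolydisk n := by
    rw [mem_smul_unitPolydisk_iff (ht0.trans htr)]
    intro j
    by_cases h : j = j₀
    · subst h; simpa [abs_of_pos ht0] using htr
    · simpa [h] using ht0.trans htr
  have hms := hr.2 _ _ (isHolomorphicWithExpansion_blaschke j₀ h0.le h1) (by simp)
    (fun z hz => norm_blaschke_lt_one h0.le h1 (hz j₀)) _ hz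
  rw [monomialSum_le_one_iff] at hms
  have hle : a * t + (1 - a ^ 2) * t ^ 2 / (1 - a * t) ≤ 1 := by
    have hsum := hasSum_norm_blaschkeCoeff h0.le h1 ht0.le ht
    refine hasSum_le_of_sum_le hsum fun s => ?_
    have e1 : ∑ k ∈ s, ‖blaschkeCoeff a k‖ * t ^ k =
        ∑ k ∈ s.erase 0, ‖blaschkeCoeff a k‖ * t ^ k := by
      symm
      apply Finset.sum_erase
      simp [blaschkeCoeff]
    rw [e1]
    have h := hms ((s.erase 0).map ⟨_, hinj⟩) (by simp)
    rw [Finset.sum_map] at h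
    refine le_trans (le_of_eq (Finset.sum_congr rfl fun k _ => ?_)) h
    simp only [Function.Embedding.coeFn_mk, hinj.extend_apply, norm_mul, norm_monom]
    congr 1
    rw [Finset.prod_eq_single j₀] <;> simp +contextual [abs_of_pos ht0]
  have hpos : 0 < 1 - a * t := by nlinarith
  have h3 : (1 - a ^ 2) * t ^ 2 / (1 - a * t) ≤ 1 - a * t := by linarith
  rw [div_le_iff₀ hpos] at h3
  -- As `1 - a² = a²`, the inequality reads `(a t)² ≤ (1 - a t)²`, that is `a t ≤ 1/2 = a²`.
  nlinarith [mul_pos h0 ht0]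

/-! ### Radius bounds from homogeneous polynomials -/

theorem differentiable_monom {n : ℕ} (α : Fin n → ℕ) : Differentiable ℂ (monom α) := by
  intro z
  have h := HasFDerivAt.finsetProd (u := Finset.univ) (x := z)
    (g := fun (j : Fin n) (w : Fin n → ℂ) => w j ^ α j)
    fun j _ => (by fun_prop : DifferentiableAt ℂ _ z).hasFDerivAt
  simpa only [monom, Finset.prod_fn] using! h.differentiableAt

open Filter Topology in
/-- A homogeneous polynomial bounded by one on the polydisk bounds the admissible radii. -/
theorem pow_mul_sum_norm_le_one {n d : ℕ} (hd : d ≠ 0) {ι : Type*} [Fintype ι]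
    {A : ι → Fin n → ℕ} (hA : Function.Injective A) (hdeg : ∀ i, ∑ j, A i j = d) {a : ι → ℂ}
    (hb : ∀ z ∈ unitPolydisk n, ‖∑ i, a i * monom (A i) z‖ < 1) {r : ℝ}
    (hr : r ∈ bohrRadiiZero n) : r ^ d * ∑ i, ‖a i‖ ≤ 1 := by
  rcases hr.1.eq_or_lt with rfl | hr0
  · simp [hd]
  have hexp : IsHolomorphicWithExpansion (fun z => ∑ i, a i * monom (A i) z)
      (Function.extend A a 0) := by
    refine ⟨?_, fun z _ => ?_⟩
    · refine DifferentiableOn.fun_sum fun i _ => DifferentiableOn.const_mul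
        (differentiable_monom (A i)).differentiableOn _
    · rw [← hA.hasSum_iff]
      · convert! hasSum_fintype (fun i => a i * monom (A i) z) using 2 with i
        simp [hA.extend_apply]
      · intro α hα
        rw [Function.extend_apply' _ _ _ (by simpa using hα)]
        simp
  have hzero : ∑ i, a i * monom (A i) (0 : Fin n → ℂ) = 0 := by
    refine Finset.sum_eq_zero fun i _ => ?_
    have : monom (A i) (0 : Fin n → ℂ) = 0 := by
      have h := monom_const (A i) 0
      rw [hdeg, zero_pow hd] at h
      exact h
    rw [this, mul_zero]
  -- The diagonal point `(r, …, r)` is outside the open polydisk `r · 𝔻ⁿ`, so test at `t < r` and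
  -- let `t → r`.
  have hcont : Continuous fun t : ℝ => t ^ d * ∑ i, ‖a i‖ := by fun_prop
  have hlim := (hcont.tendsto r).mono_left (nhdsWithin_le_nhds (s := Set.Iio r))
  refine le_of_tendsto hlim ?_
  filter_upwards [Ioo_mem_nhdsLT hr0] with t ht
  have hz : (fun _ => (t : ℂ) : Fin n → ℂ) ∈ r • unitPolydisk n := by
    rw [mem_smul_unitPolydisk_iff hr0]
    intro j
    simpa [abs_of_pos ht.1] using ht.2
  have hms := monomialSum_le_one_iff.1 (hr.2 _ _ hexp hzero hb _ hz)
    (Finset.univ.map ⟨A, hA⟩) (by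
      simp only [Finset.mem_map, Finset.mem_univ, true_and, not_exists]
      intro i hi
      apply hd
      rw [← hdeg i]
      simp [show A i = 0 from hi])
  rw [Finset.sum_map] at hms
  refine le_trans (le_of_eq ?_) hms
  rw [Finset.mul_sum]
  refine Finset.sum_congr rfl fun i _ => ?_
  simp [hA.extend_apply, monom_const, hdeg, abs_of_pos ht.1, mul_comm]

/-- The exponent of the product of one variable from each block. -/
def blockExponent {n k m : ℕ} (e : Fin k × ZMod m → Fin n) (i : Fin k → ZMod m) : Fin n → ℕ :=
  ∑ l, Pi.single (e (l, i l)) 1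

theorem monom_blockExponent {n k m : ℕ} (e : Fin k × ZMod m → Fin n) (i : Fin k → ZMod m)
    (z : Fin n → ℂ) : monom (blockExponent e i) z = ∏ l, z (e (l, i l)) := by
  simp only [monom, blockExponent, Finset.sum_apply, ← Finset.prod_pow_eq_pow_sum]
  rw [Finset.prod_comm]
  refine Finset.prod_congr rfl fun l _ => ?_
  rw [Finset.prod_eq_single (e (l, i l))] <;> simp +contextual

theorem sum_blockExponent {n k m : ℕ} (e : Fin k × ZMod m → Fin n) (i : Fin k → ZMod m) :
    ∑ j, blockExponent e i j = k := by
  simp only [blockExponent, Finset.sum_apply]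
  rw [Finset.sum_comm]
  simp

/-- Disjoint blocks let the support of the exponent reveal the index chosen in each block, so no two
coefficients of the form merge. -/
theorem blockExponent_injective {n k m : ℕ} {e : Fin k × ZMod m → Fin n}
    (he : Function.Injective e) : Function.Injective (blockExponent e) := by
  intro i i' h
  funext l
  have h1 : blockExponent e i (e (l, i l)) ≠ 0 := by
    simp only [blockExponent, Finset.sum_apply, ne_eq, Finset.sum_eq_zero_iff, not_forall]
    exact ⟨l, Finset.mem_univ l, by simp⟩
  rw [h] at h1
  simp only [blockExponent, Finset.sum_apply, ne_eq, Finset.sum_eq_zero_iff, not_forall] at h1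
  obtain ⟨l', -, h2⟩ := h1
  have h3 : e (l, i l) = e (l', i' l') := by
    by_contra hne
    exact h2 (Pi.single_eq_of_ne hne _)
  have h4 := he h3
  simp only [Prod.mk.injEq] at h4
  obtain ⟨rfl, h5⟩ := h4
  exact h5

/-- The polynomial `∑ ∏ χ(i_l i_{l+1}) ∏ z_{l, i_l}` on `k + 1` blocks of `m` variables bounds the
admissible radii. -/
theorem sq_pow_mul_pow_le_one {n k m : ℕ} (hm : m ≠ 0) (hkm : (k + 1) * m ≤ n) {r : ℝ}
    (hr : r ∈ bohrRadiiZero n) : (r ^ 2) ^ (k + 1) * (m : ℝ) ^ k ≤ 1 := by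
  have : NeZero m := ⟨hm⟩
  have hmpos : (0 : ℝ) < m := by exact_mod_cast Nat.pos_of_ne_zero hm
  obtain ⟨e⟩ : Nonempty (Fin (k + 1) × ZMod m ↪ Fin n) := by
    refine Function.Embedding.nonempty_of_card_le ?_
    simpa [ZMod.card] using hkm
  -- The chain bound is `m^(k+1) ∑ ‖z (e (0, x))‖²`, and that sum is strictly below `m` in the open
  -- polydisk; dividing by `M` makes the form less than `1`.
  set M : ℝ := √((m : ℝ) ^ (k + 2)) with hM
  have hMpos : 0 < M := Real.sqrt_pos.2 (by positivity)
  have hM2 : M ^ 2 = (m : ℝ) ^ (k + 2) := Real.sq_sqrt (by positivity)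
  set a : (Fin (k + 1) → ZMod m) → ℂ := fun i =>
    (M : ℂ)⁻¹ * ∏ j : Fin k, (ZMod.stdAddChar (i j.castSucc * i j.succ) : ℂ) with ha
  have hnorm : ∀ i, ‖a i‖ = M⁻¹ := by
    intro i
    simp [ha, norm_prod, abs_of_pos hMpos]
  have hb : ∀ z ∈ unitPolydisk n, ‖∑ i, a i * monom (blockExponent e i) z‖ < 1 := by
    intro z hz
    have h1 := norm_sq_chain_le k (fun x => z (e (0, x))) (fun j x => z (e (j.succ, x)))
      fun j x => (hz _).le
    have h2 : ∑ x : ZMod m, ‖z (e (0, x))‖ ^ 2 < m := by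
      calc ∑ x : ZMod m, ‖z (e (0, x))‖ ^ 2 < ∑ _x : ZMod m, (1 : ℝ) := by
            refine Finset.sum_lt_sum_of_nonempty Finset.univ_nonempty fun x _ => ?_
            nlinarith [hz (e (0, x)), norm_nonneg (z (e (0, x)))]
        _ = m := by simp [ZMod.card]
    have h3 : ∑ i, a i * monom (blockExponent e i) z = (M : ℂ)⁻¹ *
        ∑ i : Fin (k + 1) → ZMod m, z (e (0, i 0)) *
        ∏ j : Fin k, ((ZMod.stdAddChar (i j.castSucc * i j.succ) : ℂ) *
          z (e (j.succ, i j.succ))) := by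
      rw [Finset.mul_sum]
      refine Finset.sum_congr rfl fun i _ => ?_
      rw [monom_blockExponent, Fin.prod_univ_succ, Finset.prod_mul_distrib]
      ring
    rw [h3, norm_mul, norm_inv, Complex.norm_real, Real.norm_of_nonneg hMpos.le,
      inv_mul_lt_iff₀ hMpos, mul_one]
    refine lt_of_pow_lt_pow_left₀ 2 hMpos.le (h1.trans_lt ?_)
    rw [hM2, pow_succ (m : ℝ) (k + 1)]
    gcongr
  have h := pow_mul_sum_norm_le_one (Nat.succ_ne_zero k) (blockExponent_injective e.injective)
    (sum_blockExponent e) hb hr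
  simp only [hnorm, Finset.sum_const, Finset.card_univ, Fintype.card_fun, ZMod.card,
    Fintype.card_fin, nsmul_eq_mul, Nat.cast_pow] at h
  rw [← mul_assoc, mul_inv_le_iff₀ hMpos, one_mul] at h
  have h' : (r ^ (k + 1) * (m : ℝ) ^ (k + 1)) ^ 2 ≤ (m : ℝ) ^ (k + 2) := by
    rw [← hM2]
    have := hr.1
    gcongr
  refine le_of_mul_le_mul_right ?_ (pow_pos hmpos (k + 2))
  calc _ = (r ^ (k + 1) * (m : ℝ) ^ (k + 1)) ^ 2 := by ring
    _ ≤ _ := by rw [one_mul]; exact h'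

/-! ### Choice of the degree and numerical estimates -/

theorem le_two_mul_sqrt_div_of_pow_le {n k m : ℕ} (hm : m ≠ 0) (hkm : (k + 1) * m ≤ n) {L : ℝ}
    (hL : 0 < L) (hpow : ((n : ℝ) / (4 * L)) ^ (k + 1) ≤ (m : ℝ) ^ k) {r : ℝ}
    (hr : r ∈ bohrRadiiZero n) : r ≤ 2 * √L / √(n : ℝ) := by
  have hn : (0 : ℝ) < n := by
    have : 0 < (k + 1) * m := Nat.mul_pos k.succ_pos (Nat.pos_of_ne_zero hm)
    exact_mod_cast this.trans_le hkm
  have h1 : (r ^ 2 * ((n : ℝ) / (4 * L))) ^ (k + 1) ≤ 1 := by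
    rw [mul_pow]
    exact (by gcongr : _ ≤ (r ^ 2) ^ (k + 1) * (m : ℝ) ^ k).trans (sq_pow_mul_pow_le_one hm hkm hr)
  have h2 : r ^ 2 * ((n : ℝ) / (4 * L)) ≤ 1 :=
    (pow_le_one_iff_of_nonneg (by positivity) k.succ_ne_zero).1 h1
  have h3 : r ^ 2 ≤ (2 * √L / √(n : ℝ)) ^ 2 := by
    rw [div_pow, mul_pow, Real.sq_sqrt hL.le, Real.sq_sqrt hn.le, le_div_iff₀ hn]
    rw [mul_div_assoc', div_le_one (by positivity)] at h2
    linarith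
  exact le_of_sq_le_sq h3 (by positivity)

/-- The bound from bilinear forms, for moderate dimension. -/
theorem le_two_mul_sqrt_log_div_of_sq_le {n : ℕ} (hn : 2 ≤ n) {l : ℝ} (hl : 0 < l)
    (hlog : l ≤ Real.log n) (h : (n : ℝ) ^ 2 ≤ 8 * l ^ 2 * (n - 1)) {r : ℝ}
    (hr : r ∈ bohrRadiiZero n) : r ≤ 2 * √(Real.log n) / √(n : ℝ) := by
  have hm : (n : ℝ) - 1 ≤ 2 * (n / 2 : ℕ) := by
    have : n ≤ 2 * (n / 2) + 1 := by omega
    have : (n : ℝ) ≤ 2 * (n / 2 : ℕ) + 1 := by exact_mod_cast this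
    linarith
  refine le_two_mul_sqrt_div_of_pow_le (k := 1) (m := n / 2) (by omega) (by omega)
    (hl.trans_le hlog) ?_ hr
  calc ((n : ℝ) / (4 * Real.log n)) ^ (1 + 1) ≤ ((n : ℝ) / (4 * l)) ^ 2 := by gcongr
    _ = (n : ℝ) ^ 2 / (16 * l ^ 2) := by rw [div_pow]; ring
    _ ≤ (n / 2 : ℕ) := by
      rw [div_le_iff₀ (by positivity)]
      nlinarith [sq_nonneg l]
    _ = _ := by rw [pow_one]

/-- Here `log n ≥ 1`, so `4 log n / n ≥ 1/2` and the one-variable bound suffices. -/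
theorem le_two_mul_sqrt_log_div_of_le_eight {n : ℕ} (h2 : 2 < n) (h8 : n ≤ 8) {r : ℝ}
    (hr : r ∈ bohrRadiiZero n) : r ≤ 2 * √(Real.log n) / √(n : ℝ) := by
  have h3' : (3 : ℝ) ≤ n := by exact_mod_cast h2
  have h8' : (n : ℝ) ≤ 8 := by exact_mod_cast h8
  have hlog : 1 ≤ Real.log n := by
    rw [Real.le_log_iff_exp_le (by linarith)]
    linarith [Real.exp_one_lt_d9]
  refine (le_one_div_sqrt_two_of_mem (by omega) hr).trans ?_
  refine le_of_sq_le_sq ?_ (by positivity)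
  rw [div_pow, div_pow, mul_pow, Real.sq_sqrt (by linarith), Real.sq_sqrt (by linarith),
    Real.sq_sqrt (by linarith), div_le_div_iff₀ (by norm_num) (by linarith)]
  linarith

theorem le_two_mul_sqrt_log_div_of_large {n : ℕ} (hn : 55 ≤ n) {r : ℝ}
    (hr : r ∈ bohrRadiiZero n) : r ≤ 2 * √(Real.log n) / √(n : ℝ) := by
  have hn' : (55 : ℝ) ≤ n := by exact_mod_cast hn
  have hnpos : (0 : ℝ) < n := by linarith
  set L := Real.log n with hL
  have e1 := Real.exp_one_lt_d9
  have e2 := Real.exp_one_gt_d9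
  have hexp4 : Real.exp 4 = Real.exp 1 ^ 4 := by rw [← Real.exp_nat_mul]; norm_num
  have hsq1 : Real.exp 1 ^ 2 ≤ 7.39 := by nlinarith
  have hsq2 : 7.38 ≤ Real.exp 1 ^ 2 := by nlinarith
  have h54 : 54 ≤ Real.exp 4 := by rw [hexp4]; nlinarith
  have h55 : Real.exp 4 ≤ 55 := by rw [hexp4]; nlinarith
  have hL4 : 4 ≤ L := (Real.le_log_iff_exp_le hnpos).2 (h55.trans hn')
  -- the degree is `k + 1` with `k ≤ log n ≤ k + 1`
  obtain ⟨k, hk⟩ : ∃ k, k = ⌊L⌋₊ := ⟨_, rfl⟩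
  have hkL : (k : ℝ) ≤ L := hk ▸ Nat.floor_le (by linarith)
  have hLk : L < k + 1 := hk ▸ Nat.lt_floor_add_one L
  have hk4 : 4 ≤ k := by rw [hk]; exact Nat.le_floor (by exact_mod_cast hL4)
  have hk4' : (4 : ℝ) ≤ k := by exact_mod_cast hk4
  have hnexp : Real.exp k ≤ n := by
    rw [← Real.le_log_iff_exp_le hnpos]; exact hkL
  have hnle : (n : ℝ) ≤ Real.exp 1 ^ (k + 1) := by
    rw [← Real.exp_nat_mul, mul_one, ← Real.log_le_iff_le_exp hnpos]
    push_cast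
    exact hLk.le
  -- Tangent-line bound for `exp` at `4`, with `54 ≤ e⁴`; it makes the rounding loss `n - (k + 1) m
  -- ≤ k` negligible in `hkey`.
  have hnlow : 54 * (1 + (k - 4)) ≤ (n : ℝ) := by
    refine le_trans ?_ hnexp
    rw [show (k : ℝ) = 4 + (k - 4) by ring, Real.exp_add]
    have := Real.add_one_le_exp ((k : ℝ) - 4)
    nlinarith
  set m := n / (k + 1) with hm
  have hmn : (k + 1) * m ≤ n := Nat.mul_div_le n (k + 1)
  have hmlow : (n : ℝ) - k ≤ (k + 1) * m := by
    have : n ≤ (k + 1) * m + k := by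
      have h1 := Nat.div_add_mod n (k + 1)
      have h2 : n % (k + 1) < k + 1 := Nat.mod_lt n (Nat.succ_pos k)
      rw [← hm] at h1
      omega
    have : (n : ℝ) ≤ (k + 1) * m + k := by exact_mod_cast this
    linarith
  have hmpos : 0 < (m : ℝ) := by nlinarith
  have hm0 : m ≠ 0 := by rintro h; simp [h] at hmpos
  have hmle : (m : ℝ) ≤ Real.exp 1 ^ (k + 1) := by
    refine le_trans ?_ hnle
    exact_mod_cast Nat.div_le_self n (k + 1)
  have hkey : Real.exp 1 * n * (k + 1) ≤ 4 * k * ((k + 1) * m) := by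
    have h1 : 4 * (k : ℝ) * (n - k) ≤ 4 * k * ((k + 1) * m) := by gcongr
    have h2 : Real.exp 1 * n * (k + 1) ≤ 2.72 * n * (k + 1) := by gcongr; linarith
    have h3 : 2.72 * (n : ℝ) * (k + 1) ≤ 4 * k * (n - k) := by
      nlinarith [mul_nonneg (show 0 ≤ (k : ℝ) - 4 by linarith)
        (show 0 ≤ (n : ℝ) - 54 * (1 + (k - 4)) by linarith)]
    linarith
  have hkey2 : Real.exp 1 * (n / (4 * L)) ≤ m := by
    have h1 : Real.exp 1 * n ≤ 4 * k * m := by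
      refine le_of_mul_le_mul_right ?_ (show (0 : ℝ) < k + 1 by linarith)
      linarith
    have h2 : 4 * (k : ℝ) * m ≤ 4 * L * m := by gcongr
    rw [mul_div_assoc', div_le_iff₀ (by linarith)]
    linarith
  refine le_two_mul_sqrt_div_of_pow_le hm0 hmn (by linarith) ?_ hr
  refine le_of_mul_le_mul_left ?_ hmpos
  -- The extra factor `m ≤ n ≤ e^(k+1)` is absorbed as one factor `e` per power, which `hkey2` pays
  -- for.
  calc (m : ℝ) * ((n : ℝ) / (4 * L)) ^ (k + 1)
      ≤ Real.exp 1 ^ (k + 1) * ((n : ℝ) / (4 * L)) ^ (k + 1) := by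
        have : 0 < L := by linarith
        gcongr
    _ = (Real.exp 1 * (n / (4 * L))) ^ (k + 1) := by rw [mul_pow]
    _ ≤ (m : ℝ) ^ (k + 1) := by
        have : 0 < L := by linarith
        gcongr
    _ = m * (m : ℝ) ^ k := by ring

theorem le_two_mul_sqrt_log_div_of_mem {n : ℕ} (hn : 2 < n) {r : ℝ}
    (hr : r ∈ bohrRadiiZero n) : r ≤ 2 * √(Real.log n) / √(n : ℝ) := by
  have hnpos : (0 : ℝ) < n := by exact_mod_cast (by omega : 0 < n)
  have e1 := Real.exp_one_lt_d9
  have e0 := Real.exp_pos 1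
  have hsq : Real.exp 1 ^ 2 ≤ 7.39 := by nlinarith
  rcases le_or_gt n 8 with h8 | h8
  · exact le_two_mul_sqrt_log_div_of_le_eight hn h8 hr
  -- The bilinear condition with `l = 2` is `n² ≤ 32 (n - 1)`, which first fails at `n = 31`; from
  -- there `l = 3` is available.
  rcases le_or_gt n 30 with h30 | h30
  · have h1 : (9 : ℝ) ≤ n := by exact_mod_cast h8
    have h2 : (n : ℝ) ≤ 30 := by exact_mod_cast h30
    refine le_two_mul_sqrt_log_div_of_sq_le (by omega) two_pos ?_ (by nlinarith) hr
    rw [Real.le_log_iff_exp_le hnpos, show (2 : ℝ) = (2 : ℕ) * 1 by norm_num, Real.exp_nat_mul]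
    linarith
  rcases le_or_gt n 54 with h54 | h54
  · have h1 : (31 : ℝ) ≤ n := by exact_mod_cast h30
    have h2 : (n : ℝ) ≤ 54 := by exact_mod_cast h54
    refine le_two_mul_sqrt_log_div_of_sq_le (by omega) three_pos ?_ (by nlinarith) hr
    rw [Real.le_log_iff_exp_le hnpos, show (3 : ℝ) = (3 : ℕ) * 1 by norm_num, Real.exp_nat_mul]
    nlinarith
  · exact le_two_mul_sqrt_log_div_of_large h54 hr

theorem theorem2p4 (n : ℕ) (hn : 1 < n) :
    -- the largest admissible radius exists and is `Kₙ⁰`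
    IsGreatest (bohrRadiiZero n) (bohrRadiusZero n) ∧
    1 / √(2 * (n : ℝ)) ≤ bohrRadiusZero n ∧
    (n = 2 → bohrRadiusZero n ≤ 1 / √2) ∧
    (2 < n → bohrRadiusZero n ≤ 2 * √(Real.log n) / √(n : ℝ)) := by
  have hG := isGreatest_bohrRadiusZero hn.le
    ⟨1 / √2, fun r hr => le_one_div_sqrt_two_of_mem (by omega) hr⟩
  exact ⟨hG, hG.2 (one_div_sqrt_mem_bohrRadiiZero hn.le),
    fun _ => le_one_div_sqrt_two_of_mem (by omega) hG.1,
    fun h => le_two_mul_sqrt_log_div_of_mem h hG.1⟩
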